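/- Let $n\ge 3$. Fix a constant $c\in\{0,1\}^n$ and let $f$ be one of the twelve group-1 Preneel–Govaerts–Vandewalle (PGV) compression functions in the classification of Black, Rogaway and Shrimpton: for a block cipher $E:\{0,1\}^n\times\{0,1\}^n\to\{0,1\}^n$ (a permutation $E_K$ of $\{0,1\}^n$ for each key $K$), a PGV compression function has the form $f(h,m)=E_k(x)\oplus s$ with $k,x,s\in\{c,h,m,h\oplus m\}$, and the group-1 functions are those in which $k,x,s\in\{h,m,h\oplus m\}$, $x\ne k$ and $s\ne k$ as formal expressions; they include the Davies–Meyer function $f(h,m)=E_m(h)\oplus h$. Let $E$ be an ideal cipher, that is, a family of independent uniformly random permutations $E_K$ of $\{0,1\}^n$, and let $\mathcal A$ be any quantum algorithm that makes at most $q\ge 0$ queries to the unitary $$|b\rangle|K\rangle|x\rangle|y\rangle\mapsto|b\rangle|K\rangle|x\rangle|y\oplus E_K^{(-1)^b}(x)\rangle ,\qquad b\in\{0,1\},$$ (with no other restriction on its running time or memory) and outputs a pair $((h,m),(h',m'))$. Then $$\Pr\bigl[(h,m)\neq(h',m')\ \text{and}\ f(h,m)=f(h',m')\bigr]\le\frac{6(8q+1)^4}{2^n-4},$$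 where the probability is over $E$ and the measurement of $\mathcal A$. In particular the probability is $O(q^4/2^n)$: there is an absolute constant $C>0$ such that for all $n\ge 3$ and $q\ge1$ the right-hand side is at most $C\,q^4/2^n$. -/

import Mathlib

open scoped Matrix

namespace PGV

/-- Bit strings of length `n`. Addition is the bitwise exclusive or `⊕`. -/
abbrev Block (n : ℕ) : Type := Fin n → ZMod 2

/-- A block cipher with `n`-bit keys and `n`-bit blocks: a permutation `E K` of the blocks for
every key `K`. The ideal cipher is a uniformly random element of this finite type. -/
abbrev Cipher (n : ℕ) : Type := Block n → Equiv.Perm (Block n)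

/-! ### The PGV compression functions -/

/-- The four admissible arguments: the fixed constant `c`, the chaining value `h`, the message
block `m`, and `h ⊕ m`. -/
inductive Term where
  | const
  | chain
  | msg
  | both
  deriving DecidableEq

/-- The value of an argument at the constant `c`, chaining value `h` and message block `m`. -/
def Term.eval {n : ℕ} (c h m : Block n) : Term → Block n
  | .const => c
  | .chain => h
  | .msg => m
  | .both => h + m

/-- One of the 64 choices of key `k`, plaintext `x` and feed-forward `s`. -/
structure Scheme where
  k : Term
  x : Term
  s : Term
  deriving DecidableEq

/-- The compression function `f(h, m) = E_k(x) ⊕ s`; its argument is the pair `(h, m)`. -/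
def Scheme.compress {n : ℕ} (S : Scheme) (c : Block n) (E : Cipher n)
    (p : Block n × Block n) : Block n :=
  E (S.k.eval c p.1 p.2) (S.x.eval c p.1 p.2) + S.s.eval c p.1 p.2

/-- The twelve group-1 schemes of Black, Rogaway and Shrimpton, in their order `f_1, …, f_12`
(with `w = h ⊕ m`). -/
def groupOne : List Scheme :=
  [ ⟨.chain, .msg, .msg⟩,     -- E_h(m) ⊕ m
    ⟨.chain, .both, .both⟩,   -- E_h(w) ⊕ w
    ⟨.chain, .msg, .both⟩,    -- E_h(m) ⊕ w
    ⟨.chain, .both, .msg⟩,    -- E_h(w) ⊕ m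
    ⟨.msg, .chain, .chain⟩,   -- E_m(h) ⊕ h
    ⟨.msg, .both, .both⟩,     -- E_m(w) ⊕ w
    ⟨.msg, .chain, .both⟩,    -- E_m(h) ⊕ w
    ⟨.msg, .both, .chain⟩,    -- E_m(w) ⊕ h
    ⟨.both, .msg, .msg⟩,      -- E_w(m) ⊕ m
    ⟨.both, .chain, .chain⟩,  -- E_w(h) ⊕ h
    ⟨.both, .msg, .chain⟩,    -- E_w(m) ⊕ h
    ⟨.both, .chain, .msg⟩ ]   -- E_w(h) ⊕ m

/-- The Davies–Meyer compression function `f(h, m) = E_m(h) ⊕ h`. -/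
def daviesMeyer {n : ℕ} (E : Cipher n) (p : Block n × Block n) : Block n :=
  E p.2 p.1 + p.1

/-- `(h, m) ≠ (h', m')` is a collision of `f`. -/
def IsCollision {n : ℕ} (f : Block n × Block n → Block n)
    (o : (Block n × Block n) × (Block n × Block n)) : Prop :=
  o.1 ≠ o.2 ∧ f o.1 = f o.2

/-! ### Quantum algorithms with access to a cipher and its inverse -/

/-- Labels of the computational basis `|b⟩|K⟩|x⟩|y⟩|w⟩`: the direction bit `b` (`false` for `E`,
`true` for `E⁻¹`), the query registers `K`, `x`, `y`, and a workspace register `w`. -/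
abbrev Basis (n : ℕ) (W : Type*) : Type _ :=
  Bool × Block n × Block n × Block n × W

/-- The action of the cipher oracle on basis labels:
`|b⟩|K⟩|x⟩|y⟩|w⟩ ↦ |b⟩|K⟩|x⟩|y ⊕ E_K(x)⟩|w⟩` if `b = 0`, and
`|b⟩|K⟩|x⟩|y⟩|w⟩ ↦ |b⟩|K⟩|x⟩|y ⊕ E_K⁻¹(x)⟩|w⟩` if `b = 1`. -/
def oracleMap {n : ℕ} {W : Type*} (E : Cipher n) : Basis n W → Basis n W
  | (false, K, x, y, w) => (false, K, x, y + E K x, w)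
  | (true, K, x, y, w) => (true, K, x, y + (E K).symm x, w)

/-- The oracle unitary `U_E`, as the matrix with `U_E |s⟩ = |oracleMap E s⟩`. -/
def oracle {n : ℕ} {W : Type*} [DecidableEq W] (E : Cipher n) :
    Matrix (Basis n W) (Basis n W) ℂ :=
  Matrix.of fun t s => if t = oracleMap E s then 1 else 0

/-- A quantum oracle algorithm whose output is a pair of inputs `((h, m), (h', m'))` of a
compression function. It starts in a basis state, applies the unitary `first`, then for each
unitary `V` of the list `steps` makes one oracle query and applies `V`; finally it measures all
registers in the computational basis and applies `output` to the result. Nothing in the algorithm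
depends on the cipher except through the queries. -/
structure QuantumAlgorithm (n : ℕ) (W : Type*) [Fintype W] [DecidableEq W] where
  start : Basis n W
  first : Matrix.unitaryGroup (Basis n W) ℂ
  steps : List (Matrix.unitaryGroup (Basis n W) ℂ)
  output : Basis n W → (Block n × Block n) × (Block n × Block n)

namespace QuantumAlgorithm

variable {n : ℕ} {W : Type*} [Fintype W] [DecidableEq W]

/-- The number of oracle queries (forward and backward together). -/
def numQueries (A : QuantumAlgorithm n W) : ℕ := A.steps.length

/-- The state immediately before the final measurement, when the oracle is `E`. -/
def finalState (A : QuantumAlgorithm n W) (E : Cipher n) : Basis n W → ℂ :=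
  A.steps.foldl (fun ψ V => V.1 *ᵥ (oracle E *ᵥ ψ)) (A.first.1 *ᵥ Pi.single A.start 1)

open scoped Classical in
/-- The probability that the output is a collision of `f E`, when the oracle is `E`. -/
noncomputable def collisionProbAt (A : QuantumAlgorithm n W)
    (f : Cipher n → Block n × Block n → Block n) (E : Cipher n) : ℝ :=
  ∑ s : Basis n W, if IsCollision (f E) (A.output s) then ‖A.finalState E s‖ ^ 2 else 0

/-- The probability that the output is a collision of `f E`, over an ideal cipher `E` and the
final measurement. -/
noncomputable def collisionProb (A : QuantumAlgorithm n W)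
    (f : Cipher n → Block n × Block n → Block n) : ℝ :=
  (∑ E : Cipher n, A.collisionProbAt f E) / (Fintype.card (Cipher n) : ℝ)

end QuantumAlgorithm

end PGV

/-! Fix an ordered pair of distinct inputs and a value `v`. A cipher sending both inputs to `v` can
be obtained from an arbitrary cipher by two transpositions. By counting (`mul_sum_prescribed_le`),
the sum over such ciphers is at most the sum over reprogrammed ciphers divided by `(N - 1)(N - 2)`,
where `N = 2 ^ n`. It thus suffices to fix `E` and `v` and bound the sum, over all pairs, of the
probability of outputting the very pair at which the oracle was reprogrammed.

When the two reprogrammings do not interfere, their oracle matrices satisfy `U₂ = U₁ p + U₁ p' -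
U₀`. The final state then splits into the unperturbed state, one first-order term for each input,
and a second-order remainder. Since a basis label sees at most two of all the single reprogrammings,
these terms have `ℓ²` size at most `1`, `3q`, `3q` and `9q²` after projection and summation over
pairs (`sum_output_evolve_le`). Their sum is `(1 + 3q)²`, and squaring gives `(1 + 3q)⁴`. Summing
over the `N` values of `v` gives `N(1 + 3q)⁴ / ((N - 1)(N - 2))`. -/

namespace PGV

/-! ### Perturbation of query algorithms in `ℓ²` -/

section Perturbation

variable {ι P : Type*}

/-- The squared `ℓ²` norm of a vector. -/
noncomputable def sqNorm [Fintype ι] (ψ : ι → ℂ) : ℝ := ∑ i, ‖ψ i‖ ^ 2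

lemma sqNorm_nonneg [Fintype ι] (ψ : ι → ℂ) : 0 ≤ sqNorm ψ :=
  Finset.sum_nonneg fun _ _ => sq_nonneg _

/-- Minkowski's inequality for finite sums of squares. -/
lemma sum_norm_add_sq_le (T : Finset ι) (f g : ι → ℂ) {a b : ℝ} (ha : 0 ≤ a) (hb : 0 ≤ b)
    (hf : ∑ i ∈ T, ‖f i‖ ^ 2 ≤ a ^ 2) (hg : ∑ i ∈ T, ‖g i‖ ^ 2 ≤ b ^ 2) :
    ∑ i ∈ T, ‖f i + g i‖ ^ 2 ≤ (a + b) ^ 2 := by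
  have hcross : ∑ i ∈ T, ‖f i‖ * ‖g i‖ ≤ a * b := by
    refine le_of_sq_le_sq ?_ (mul_nonneg ha hb)
    calc (∑ i ∈ T, ‖f i‖ * ‖g i‖) ^ 2
        ≤ (∑ i ∈ T, ‖f i‖ ^ 2) * ∑ i ∈ T, ‖g i‖ ^ 2 := Finset.sum_mul_sq_le_sq_mul_sq _ _ _
      _ ≤ a ^ 2 * b ^ 2 :=
          mul_le_mul hf hg (Finset.sum_nonneg fun _ _ => sq_nonneg _) (sq_nonneg a)
      _ = (a * b) ^ 2 := by ring
  calc ∑ i ∈ T, ‖f i + g i‖ ^ 2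
      ≤ ∑ i ∈ T, (‖f i‖ ^ 2 + 2 * (‖f i‖ * ‖g i‖) + ‖g i‖ ^ 2) := by
        refine Finset.sum_le_sum fun i _ => ?_
        have := pow_le_pow_left₀ (norm_nonneg _) (norm_add_le (f i) (g i)) 2
        linarith
    _ = ∑ i ∈ T, ‖f i‖ ^ 2 + 2 * ∑ i ∈ T, ‖f i‖ * ‖g i‖ + ∑ i ∈ T, ‖g i‖ ^ 2 := by
        rw [Finset.sum_add_distrib, Finset.sum_add_distrib, Finset.mul_sum]
    _ ≤ (a + b) ^ 2 := by nlinarith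

/-- Minkowski's inequality for families of vectors. -/
lemma sum_sqNorm_add_le [Fintype ι] (T : Finset P) (f g : P → ι → ℂ) {a b : ℝ} (ha : 0 ≤ a)
    (hb : 0 ≤ b) (hf : ∑ p ∈ T, sqNorm (f p) ≤ a ^ 2) (hg : ∑ p ∈ T, sqNorm (g p) ≤ b ^ 2) :
    ∑ p ∈ T, sqNorm (f p + g p) ≤ (a + b) ^ 2 := by
  simp only [sqNorm, ← Finset.sum_product'] at *
  exact sum_norm_add_sq_le (T ×ˢ Finset.univ) (fun i => f i.1 i.2) (fun i => g i.1 i.2) ha hb hf hg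

variable [Fintype ι] [DecidableEq ι]

lemma sqNorm_unitary_mulVec (V : Matrix.unitaryGroup ι ℂ) (ψ : ι → ℂ) :
    sqNorm (V.1 *ᵥ ψ) = sqNorm ψ := by
  have h (φ : ι → ℂ) : ((sqNorm φ : ℝ) : ℂ) = star φ ⬝ᵥ φ := by
    simp only [sqNorm, dotProduct, Pi.star_apply, RCLike.star_def, Complex.conj_mul']
    push_cast
    rfl
  have hV : V.1ᴴ * V.1 = 1 := Matrix.mem_unitaryGroup_iff'.1 V.2
  apply Complex.ofReal_injective
  rw [h, h, Matrix.star_mulVec, Matrix.dotProduct_mulVec, Matrix.vecMul_vecMul, hV,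
    Matrix.vecMul_one]

/-- The state reached from `ψ` when each unitary of the list is preceded by a query to `U`. -/
def evolve (U : Matrix ι ι ℂ) (l : List (Matrix.unitaryGroup ι ℂ)) (ψ : ι → ℂ) : ι → ℂ :=
  l.foldl (fun φ V => V.1 *ᵥ (U *ᵥ φ)) ψ

lemma evolve_nil (U : Matrix ι ι ℂ) (ψ : ι → ℂ) : evolve U [] ψ = ψ := rfl

lemma evolve_append_singleton (U : Matrix ι ι ℂ) (l : List (Matrix.unitaryGroup ι ℂ))
    (V : Matrix.unitaryGroup ι ℂ) (ψ : ι → ℂ) :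
    evolve U (l ++ [V]) ψ = V.1 *ᵥ (U *ᵥ evolve U l ψ) := by
  simp [evolve]

lemma sqNorm_evolve {U : Matrix ι ι ℂ} (hU : ∀ φ, sqNorm (U *ᵥ φ) = sqNorm φ)
    (l : List (Matrix.unitaryGroup ι ℂ)) (ψ : ι → ℂ) : sqNorm (evolve U l ψ) = sqNorm ψ := by
  induction l using List.reverseRecOn with
  | nil => rfl
  | append_singleton l V ih =>
    rw [evolve_append_singleton, sqNorm_unitary_mulVec, hU, ih]

/-- First-order perturbation bound: replacing `U₀` by `U₁ p` moves the state by an amount that is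
small on average over `p`. -/
lemma sum_sqNorm_evolve_sub_le [Fintype P] {U₀ : Matrix ι ι ℂ} {U₁ : P → Matrix ι ι ℂ}
    (h₀ : ∀ φ, sqNorm (U₀ *ᵥ φ) = sqNorm φ) (h₁ : ∀ p φ, sqNorm (U₁ p *ᵥ φ) = sqNorm φ)
    (hD : ∀ φ, ∑ p, sqNorm ((U₁ p - U₀) *ᵥ φ) ≤ 9 * sqNorm φ)
    (l : List (Matrix.unitaryGroup ι ℂ)) {ψ : ι → ℂ} (hψ : sqNorm ψ = 1) :
    ∑ p, sqNorm (evolve (U₁ p) l ψ - evolve U₀ l ψ) ≤ (3 * (l.length : ℝ)) ^ 2 := by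
  induction l using List.reverseRecOn with
  | nil => simp [evolve_nil, sqNorm]
  | append_singleton l V ih =>
    -- The old error is carried along isometrically; the new error acts on the unperturbed state,
    -- which does not depend on `p`, so `hD` applies.
    have hstep (p : P) : sqNorm (evolve (U₁ p) (l ++ [V]) ψ - evolve U₀ (l ++ [V]) ψ)
        = sqNorm (U₁ p *ᵥ (evolve (U₁ p) l ψ - evolve U₀ l ψ)
          + (U₁ p - U₀) *ᵥ evolve U₀ l ψ) := by
      rw [evolve_append_singleton, evolve_append_singleton, ← Matrix.mulVec_sub,
        sqNorm_unitary_mulVec, Matrix.mulVec_sub, Matrix.sub_mulVec]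
      congr 1
      abel
    simp only [hstep]
    refine (sum_sqNorm_add_le (a := 3 * (l.length : ℝ)) (b := 3) _ _ _ (by positivity)
      (by norm_num) ?_ ?_).trans_eq ?_
    · simpa only [h₁] using ih
    · refine (hD _).trans ?_
      rw [sqNorm_evolve h₀, hψ]
      norm_num
    · simp only [List.length_append, List.length_singleton]
      push_cast
      ring

/-- Second-order perturbation bound, over pairs for which the two perturbations add up. -/
lemma sum_sqNorm_evolve_second_le [Fintype P] {U₀ : Matrix ι ι ℂ} {U₁ : P → Matrix ι ι ℂ}
    {U₂ : P × P → Matrix ι ι ℂ} {T : Finset (P × P)}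
    (h₀ : ∀ φ, sqNorm (U₀ *ᵥ φ) = sqNorm φ) (h₁ : ∀ p φ, sqNorm (U₁ p *ᵥ φ) = sqNorm φ)
    (h₂ : ∀ t φ, sqNorm (U₂ t *ᵥ φ) = sqNorm φ)
    (hD : ∀ φ, ∑ p, sqNorm ((U₁ p - U₀) *ᵥ φ) ≤ 9 * sqNorm φ)
    (hT : ∀ t ∈ T, U₂ t = U₁ t.1 + U₁ t.2 - U₀)
    (l : List (Matrix.unitaryGroup ι ℂ)) {ψ : ι → ℂ} (hψ : sqNorm ψ = 1) :
    ∑ t ∈ T, sqNorm (evolve (U₂ t) l ψ - evolve (U₁ t.1) l ψ - evolve (U₁ t.2) l ψ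
      + evolve U₀ l ψ) ≤ (9 * (l.length : ℝ) ^ 2) ^ 2 := by
  induction l using List.reverseRecOn with
  | nil => simp [evolve_nil, sqNorm]
  | append_singleton l V ih =>
    set β : P → ι → ℂ := fun p => evolve (U₁ p) l ψ - evolve U₀ l ψ with hβ
    have hβle : ∑ p, sqNorm (β p) ≤ (3 * (l.length : ℝ)) ^ 2 :=
      sum_sqNorm_evolve_sub_le h₀ h₁ hD l hψ
    -- Additivity `hT` cancels all zeroth- and first-order terms, leaving only one perturbation
    -- applied to the first-order error of the other.
    have hstep (t : P × P) (ht : t ∈ T) :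
        sqNorm (evolve (U₂ t) (l ++ [V]) ψ - evolve (U₁ t.1) (l ++ [V]) ψ
          - evolve (U₁ t.2) (l ++ [V]) ψ + evolve U₀ (l ++ [V]) ψ)
        = sqNorm (U₂ t *ᵥ (evolve (U₂ t) l ψ - evolve (U₁ t.1) l ψ - evolve (U₁ t.2) l ψ
          + evolve U₀ l ψ) + ((U₁ t.1 - U₀) *ᵥ β t.2 + (U₁ t.2 - U₀) *ᵥ β t.1)) := by
      simp only [evolve_append_singleton, ← Matrix.mulVec_sub, ← Matrix.mulVec_add]
      rw [sqNorm_unitary_mulVec]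
      simp only [hβ, Matrix.mulVec_sub, Matrix.mulVec_add, Matrix.sub_mulVec]
      rw [hT t ht]
      simp only [Matrix.sub_mulVec, Matrix.add_mulVec]
      congr 1
      abel
    have hcross : ∑ t : P × P, sqNorm ((U₁ t.1 - U₀) *ᵥ β t.2) ≤ (9 * (l.length : ℝ)) ^ 2 := by
      rw [Fintype.sum_prod_type_right]
      calc ∑ p', ∑ p, sqNorm ((U₁ p - U₀) *ᵥ β p') ≤ ∑ p', 9 * sqNorm (β p') :=
            Finset.sum_le_sum fun p' _ => hD _
        _ ≤ (9 * (l.length : ℝ)) ^ 2 := by rw [← Finset.mul_sum]; linarith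
    have hcross' : ∑ t : P × P, sqNorm ((U₁ t.2 - U₀) *ᵥ β t.1) ≤ (9 * (l.length : ℝ)) ^ 2 := by
      rw [Fintype.sum_prod_type] at *
      rw [Finset.sum_comm]
      exact hcross
    rw [Finset.sum_congr rfl hstep]
    have hsub (f : P × P → ι → ℂ) : ∑ t ∈ T, sqNorm (f t) ≤ ∑ t, sqNorm (f t) :=
      Finset.sum_le_univ_sum_of_nonneg fun _ => sqNorm_nonneg _
    refine (sum_sqNorm_add_le (a := 9 * (l.length : ℝ) ^ 2)
      (b := 9 * (l.length : ℝ) + 9 * (l.length : ℝ)) _ _ _ (by positivity) (by positivity)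
      ?_ ?_).trans ?_
    · simpa only [h₂] using ih
    · exact sum_sqNorm_add_le _ _ _ (by positivity) (by positivity)
        ((hsub _).trans hcross) ((hsub _).trans hcross')
    · simp only [List.length_append, List.length_singleton]
      push_cast
      exact pow_le_pow_left₀ (by positivity) (by nlinarith) 2

/-- If each pair `t` is read off the final state with oracle `U₂ t`, then the probabilities of
outputting `t` sum to at most `(1 + 3q)⁴`. -/
lemma sum_output_evolve_le [Fintype P] [DecidableEq P] {U₀ : Matrix ι ι ℂ}
    {U₁ : P → Matrix ι ι ℂ} {U₂ : P × P → Matrix ι ι ℂ} {T : Finset (P × P)}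
    (h₀ : ∀ φ, sqNorm (U₀ *ᵥ φ) = sqNorm φ) (h₁ : ∀ p φ, sqNorm (U₁ p *ᵥ φ) = sqNorm φ)
    (h₂ : ∀ t φ, sqNorm (U₂ t *ᵥ φ) = sqNorm φ)
    (hD : ∀ φ, ∑ p, sqNorm ((U₁ p - U₀) *ᵥ φ) ≤ 9 * sqNorm φ)
    (hT : ∀ t ∈ T, U₂ t = U₁ t.1 + U₁ t.2 - U₀)
    (l : List (Matrix.unitaryGroup ι ℂ)) {ψ : ι → ℂ} (hψ : sqNorm ψ = 1) (out : ι → P × P) :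
    ∑ t ∈ T, ∑ i, (if out i = t then ‖evolve (U₂ t) l ψ i‖ ^ 2 else 0)
      ≤ (1 + 3 * (l.length : ℝ)) ^ 4 := by
  set L : ℝ := (l.length : ℝ) with hL
  have hL0 : 0 ≤ L := by positivity
  set proj : P × P → (ι → ℂ) → ι → ℂ := fun t φ i => if out i = t then φ i else 0 with hproj
  have hproj_le (t : P × P) (φ : ι → ℂ) : sqNorm (proj t φ) ≤ sqNorm φ :=
    Finset.sum_le_sum fun i _ => by
      simp only [hproj]
      split_ifs <;> simp
  have hproj_eq (t : P × P) (φ : ι → ℂ) :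
      sqNorm (proj t φ) = ∑ i, if out i = t then ‖φ i‖ ^ 2 else 0 :=
    Finset.sum_congr rfl fun i _ => by
      simp only [hproj]
      split_ifs <;> simp
  have hsub (f : P × P → ι → ℂ) : ∑ t ∈ T, sqNorm (f t) ≤ ∑ t, sqNorm (f t) :=
    Finset.sum_le_univ_sum_of_nonneg fun _ => sqNorm_nonneg _
  set β : P → ι → ℂ := fun p => evolve (U₁ p) l ψ - evolve U₀ l ψ with hβ
  have hβle : ∑ p, sqNorm (β p) ≤ (3 * L) ^ 2 := sum_sqNorm_evolve_sub_le h₀ h₁ hD l hψ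
  have hα : ∑ t, sqNorm (proj t (evolve U₀ l ψ)) ≤ 1 ^ 2 := by
    simp only [hproj_eq]
    rw [Finset.sum_comm]
    simp only [Finset.sum_ite_eq, Finset.mem_univ, if_true]
    rw [one_pow]
    exact ((sqNorm_evolve h₀ l ψ).trans hψ).le
  -- For fixed `p`, the projections onto outputs `(p, p')` are mutually orthogonal, so summing over
  -- `p'` costs no factor.
  have hβ₁ : ∑ t : P × P, sqNorm (proj t (β t.1)) ≤ (3 * L) ^ 2 := by
    refine le_trans ?_ hβle
    rw [Fintype.sum_prod_type]
    refine Finset.sum_le_sum fun p _ => ?_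
    simp only [hproj_eq]
    rw [Finset.sum_comm]
    refine Finset.sum_le_sum fun i _ => ?_
    simp only [Prod.ext_iff, ite_and]
    split_ifs <;> simp
  have hβ₂ : ∑ t : P × P, sqNorm (proj t (β t.2)) ≤ (3 * L) ^ 2 := by
    refine le_trans ?_ hβle
    rw [Fintype.sum_prod_type_right]
    refine Finset.sum_le_sum fun p _ => ?_
    simp only [hproj_eq]
    rw [Finset.sum_comm]
    refine Finset.sum_le_sum fun i _ => ?_
    simp only [Prod.ext_iff, and_comm (a := (out i).1 = _), ite_and]
    split_ifs <;> simp
  set δ : P × P → ι → ℂ := fun t =>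
    evolve (U₂ t) l ψ - evolve (U₁ t.1) l ψ - evolve (U₁ t.2) l ψ + evolve U₀ l ψ with hδ
  have hδle : ∑ t ∈ T, sqNorm (proj t (δ t)) ≤ (9 * L ^ 2) ^ 2 :=
    (Finset.sum_le_sum fun t _ => hproj_le t _).trans
      (sum_sqNorm_evolve_second_le h₀ h₁ h₂ hD hT l hψ)
  have hdecomp (t : P × P) : proj t (evolve (U₂ t) l ψ)
      = (proj t (δ t) + proj t (evolve U₀ l ψ)) + (proj t (β t.1) + proj t (β t.2)) := by
    ext i
    simp only [hproj, hδ, hβ, Pi.add_apply, Pi.sub_apply]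
    split_ifs
    · ring
    · simp
  simp only [← hproj_eq, hdecomp]
  refine (sum_sqNorm_add_le (a := 9 * L ^ 2 + 1) (b := 3 * L + 3 * L) _ _ _ (by positivity)
    (by positivity) (sum_sqNorm_add_le _ _ _ (by positivity) zero_le_one hδle ((hsub _).trans hα))
    (sum_sqNorm_add_le _ _ _ (by positivity) (by positivity) ((hsub _).trans hβ₁)
      ((hsub _).trans hβ₂))).trans_eq ?_
  ring

end Perturbation

end PGV

namespace PGV

/-! ### Reprogramming a cipher by transpositions -/

section Reprogramming

variable {n : ℕ}

lemma Block.add_self (a : Block n) : a + a = 0 := by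
  ext i
  exact CharTwo.add_self_eq_zero (a i)

lemma Block.add_add_cancel (a b : Block n) : a + b + b = a := by
  rw [add_assoc, Block.add_self, add_zero]

/-- The cipher `E` changed by a transposition so that it maps `x` to `y` under the key `k`. -/
def reprogram (E : Cipher n) (k x y : Block n) : Cipher n :=
  Function.update E k (Equiv.swap (E k x) y * E k)

lemma reprogram_same_key (E : Cipher n) (k x y : Block n) :
    reprogram E k x y k = Equiv.swap (E k x) y * E k := Function.update_self ..

lemma reprogram_of_key_ne (E : Cipher n) {K k : Block n} (x y : Block n) (h : K ≠ k) :
    reprogram E k x y K = E K := Function.update_of_ne h ..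

lemma reprogram_apply_self (E : Cipher n) (k x y : Block n) : reprogram E k x y k x = y := by
  simp [reprogram_same_key]

lemma reprogram_apply_of_ne (E : Cipher n) {k x y K X : Block n} (h : (K, X) ≠ (k, x))
    (hy : E K X ≠ y) : reprogram E k x y K X = E K X := by
  by_cases hK : K = k
  · subst hK
    rw [reprogram_same_key, Equiv.Perm.mul_apply, Equiv.swap_apply_of_ne_of_ne _ hy]
    exact fun hX => h (by rw [(E K).injective hX])
  · rw [reprogram_of_key_ne E x y hK]

/-- The restoring step uses the same transposition, which is an involution. This inverts
reprogramming in the counting argument. -/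
lemma reprogram_reprogram (E : Cipher n) (k x z : Block n) :
    reprogram (reprogram E k x z) k x (E k x) = E := by
  funext K
  by_cases hK : K = k
  · subst hK
    rw [reprogram_same_key, reprogram_same_key, Equiv.Perm.mul_apply, Equiv.swap_apply_left,
      Equiv.swap_comm, Equiv.swap_mul_self_mul]
  · rw [reprogram_of_key_ne _ _ _ hK, reprogram_of_key_ne _ _ _ hK]

/-- Two reprogrammings that do not interfere act on disjoint sets of points. -/
lemma reprogram_reprogram_dichotomy (E : Cipher n) {k x y k' x' y' : Block n}
    (hne : (k, x) ≠ (k', x')) (hy : k = k' → y ≠ y') (h : E k x ≠ y') (h' : E k' x' ≠ y)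
    (K : Block n) (s : Bool × Block n) :
    let ev : Cipher n → Block n := fun F => if s.1 then (F K).symm s.2 else F K s.2
    let F := reprogram (reprogram E k x y) k' x' y'
    (ev F = ev (reprogram E k x y) ∧ ev (reprogram E k' x' y') = ev E) ∨
      (ev F = ev (reprogram E k' x' y') ∧ ev (reprogram E k x y) = ev E) := by
  intro ev F
  by_cases hK' : K = k'
  swap
  · left
    simp only [ev, F, reprogram_of_key_ne _ x' y' hK', and_self]
  subst hK'
  by_cases hK : K = k
  swap
  · right
    have hG : reprogram E k x y K = E K := reprogram_of_key_ne E x y hK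
    simp only [ev, F, reprogram_same_key, hG, and_self]
  subst hK
  -- Under a common key, the pairs `{E K x, y}` and `{E K x', y'}` are disjoint. The two
  -- transpositions therefore have disjoint supports, and each value is moved by at most one of
  -- them.
  have hx : E K x ≠ E K x' := fun he => hne (by rw [(E K).injective he])
  have hGx' : reprogram E K x y K x' = E K x' :=
    reprogram_apply_of_ne E hne.symm h'
  have hF : F K = Equiv.swap (E K x') y' * (Equiv.swap (E K x) y * E K) := by
    simp only [F]
    rw [reprogram_same_key, hGx', reprogram_same_key]
  have hyy := hy rfl
  obtain ⟨b, X⟩ := s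
  cases b
  · simp only [ev, Bool.false_eq_true, if_false, hF, reprogram_same_key, Equiv.Perm.mul_apply]
    generalize E K X = z at *
    by_cases hz : z = E K x' ∨ z = y'
    · right
      have : Equiv.swap (E K x) y z = z := by
        apply Equiv.swap_apply_of_ne_of_ne <;> grind
      simp only [this, and_self]
    · left
      push Not at hz
      have h1 : Equiv.swap (E K x') y' z = z := Equiv.swap_apply_of_ne_of_ne hz.1 hz.2
      refine ⟨?_, h1⟩
      apply Equiv.swap_apply_of_ne_of_ne <;> simp only [Equiv.swap_apply_def] <;> split_ifs <;> grind
  · simp only [ev, if_true, hF, reprogram_same_key, ← Equiv.Perm.inv_def, mul_inv_rev,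
      Equiv.swap_inv, Equiv.Perm.mul_apply]
    by_cases hz : X = E K x' ∨ X = y'
    · right
      have : Equiv.swap (E K x) y X = X := by
        apply Equiv.swap_apply_of_ne_of_ne <;> grind
      refine ⟨?_, by rw [this]⟩
      congr 1
      apply Equiv.swap_apply_of_ne_of_ne <;> simp only [Equiv.swap_apply_def] <;> split_ifs <;> grind
    · left
      push Not at hz
      have h1 : Equiv.swap (E K x') y' X = X := Equiv.swap_apply_of_ne_of_ne hz.1 hz.2
      simp only [h1, and_self]

end Reprogramming

/-! ### Oracle matrices and their differences -/

section Oracle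

variable {n : ℕ} {W : Type*}

lemma oracleMap_eq (E : Cipher n) (b : Bool) (K x y : Block n) (w : W) :
    oracleMap E (b, K, x, y, w) = (b, K, x, y + (if b then (E K).symm x else E K x), w) := by
  cases b <;> rfl

lemma oracleMap_involutive (E : Cipher n) :
    Function.Involutive (oracleMap E : Basis n W → Basis n W) := by
  rintro ⟨b, K, x, y, w⟩
  rw [oracleMap_eq, oracleMap_eq, Block.add_add_cancel]

/-- An oracle only shifts the `y` register, and disagreement of two oracles at a label does not
depend on that register. -/
lemma oracleMap_ne_iff (E F G : Cipher n) (t : Basis n W) :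
    oracleMap F (oracleMap G t) ≠ oracleMap E (oracleMap G t) ↔ oracleMap F t ≠ oracleMap E t := by
  obtain ⟨b, K, x, y, w⟩ := t
  simp only [oracleMap_eq, ne_eq, Prod.mk.injEq, add_right_inj, true_and, and_true]

lemma oracle_mulVec [Fintype W] [DecidableEq W] (E : Cipher n) (ψ : Basis n W → ℂ) (t : Basis n W) :
    (oracle E *ᵥ ψ) t = ψ (oracleMap E t) := by
  have h (s : Basis n W) : t = oracleMap E s ↔ oracleMap E t = s :=
    ⟨fun h => by rw [h, oracleMap_involutive], fun h => by rw [← h, oracleMap_involutive]⟩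
  simp [Matrix.mulVec, dotProduct, oracle, h]

lemma sum_comp_oracleMap [Fintype W] (E : Cipher n) (f : Basis n W → ℝ) :
    ∑ t, f (oracleMap E t) = ∑ t, f t :=
  Equiv.sum_comp (oracleMap_involutive E).toPerm f

lemma sqNorm_oracle_mulVec [Fintype W] [DecidableEq W] (E : Cipher n) (ψ : Basis n W → ℂ) :
    sqNorm (oracle E *ᵥ ψ) = sqNorm ψ := by
  simp only [sqNorm, oracle_mulVec]
  exact sum_comp_oracleMap E fun t => ‖ψ t‖ ^ 2

/-- Two oracles differ at most by the weight of the labels on which they disagree. -/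
lemma sqNorm_oracle_sub_mulVec_le [Fintype W] [DecidableEq W] (E F : Cipher n) (ψ : Basis n W → ℂ) :
    sqNorm ((oracle F - oracle E) *ᵥ ψ)
      ≤ 4 * ∑ t, if oracleMap F t ≠ oracleMap E t then ‖ψ t‖ ^ 2 else 0 := by
  set B : Basis n W → ℝ := fun t => if oracleMap F t ≠ oracleMap E t then ‖ψ t‖ ^ 2 else 0 with hB
  have hpt (t : Basis n W) : ‖((oracle F - oracle E) *ᵥ ψ) t‖ ^ 2
      ≤ 2 * B (oracleMap F t) + 2 * B (oracleMap E t) := by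
    simp only [hB, oracleMap_ne_iff, Matrix.sub_mulVec, Pi.sub_apply, oracle_mulVec]
    split_ifs with h
    · have h1 := pow_le_pow_left₀ (norm_nonneg _)
        (norm_sub_le (ψ (oracleMap F t)) (ψ (oracleMap E t))) 2
      nlinarith [sq_nonneg (‖ψ (oracleMap F t)‖ - ‖ψ (oracleMap E t)‖)]
    · rw [not_not.1 h]
      simp
  calc sqNorm ((oracle F - oracle E) *ᵥ ψ)
      ≤ ∑ t, (2 * B (oracleMap F t) + 2 * B (oracleMap E t)) := Finset.sum_le_sum fun t _ => hpt t
    _ = 4 * ∑ t, B t := by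
      rw [Finset.sum_add_distrib, ← Finset.mul_sum, ← Finset.mul_sum, sum_comp_oracleMap,
        sum_comp_oracleMap]
      ring

lemma oracle_reprogram_reprogram [DecidableEq W] (E : Cipher n) {k x y k' x' y' : Block n}
    (hne : (k, x) ≠ (k', x')) (hy : k = k' → y ≠ y') (h : E k x ≠ y') (h' : E k' x' ≠ y) :
    (oracle (reprogram (reprogram E k x y) k' x' y') : Matrix (Basis n W) (Basis n W) ℂ)
      = oracle (reprogram E k x y) + oracle (reprogram E k' x' y') - oracle E := by
  ext t ⟨b, K, X, Y, w⟩
  simp only [oracle, Matrix.of_apply, Matrix.add_apply, Matrix.sub_apply, oracleMap_eq]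
  rcases reprogram_reprogram_dichotomy E hne hy h h' K (b, X) with ⟨h1, h2⟩ | ⟨h1, h2⟩
  · simp only at h1 h2
    rw [h1, h2]
    ring
  · simp only at h1 h2
    rw [h1, h2]
    ring

/-- A basis label is affected by at most two of the reprogrammings that give all inputs `p` the
common value `v`. -/
lemma card_oracleMap_reprogram_ne_le [DecidableEq W] {P : Type*} [Fintype P] [DecidableEq P]
    {kf xf sf : P → Block n}
    (hx : Function.Injective fun p => (kf p, xf p)) (hs : Function.Injective fun p => (kf p, sf p))
    (E : Cipher n) (v : Block n) (t : Basis n W) :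
    (Finset.univ.filter fun p =>
      oracleMap (reprogram E (kf p) (xf p) (v + sf p)) t ≠ oracleMap E t).card ≤ 2 := by
  obtain ⟨b, K, X, Y, w⟩ := t
  -- In either direction the query reads the single entry `x₀ ↦ y₀` of `E K`. It changes only if the
  -- input `x₀` is reassigned or the value `y₀` is claimed; injectivity allows one `p` for each.
  set x₀ := if b then (E K).symm X else X with hx₀
  set y₀ := if b then X else E K X with hy₀
  have hsub : (Finset.univ.filter fun p =>
      oracleMap (reprogram E (kf p) (xf p) (v + sf p)) (b, K, X, Y, w)
        ≠ oracleMap E (b, K, X, Y, w)) ⊆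
      (Finset.univ.filter fun p => (kf p, xf p) = (K, x₀)) ∪
        Finset.univ.filter fun p => (kf p, sf p) = (K, y₀ + v) := by
    intro p hp
    simp only [Finset.mem_filter, Finset.mem_univ, true_and, Finset.mem_union] at hp ⊢
    by_contra hcon
    push Not at hcon
    apply hp
    rw [oracleMap_eq, oracleMap_eq]
    by_cases hK : kf p = K
    swap
    · rw [reprogram_of_key_ne E _ _ (Ne.symm hK)]
    have hyv : y₀ ≠ v + sf p := fun he => hcon.2 (by
      rw [hK, he, add_comm v, Block.add_add_cancel])
    have hE : reprogram E (kf p) (xf p) (v + sf p) K x₀ = E K x₀ := by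
      refine reprogram_apply_of_ne E hcon.1.symm ?_
      convert hyv using 1
      cases b <;> simp [hx₀, hy₀]
    cases b
    · simp only [Bool.false_eq_true, if_false] at hx₀ hE ⊢
      rw [hx₀] at hE
      rw [hE]
    · simp only [if_true] at hx₀ hE ⊢
      rw [hx₀, Equiv.apply_symm_apply] at hE
      rw [Equiv.symm_apply_eq _ |>.2 hE.symm]
  refine (Finset.card_le_card hsub).trans ((Finset.card_union_le _ _).trans ?_)
  have h1 : (Finset.univ.filter fun p => (kf p, xf p) = (K, x₀)).card ≤ 1 :=
    Finset.card_le_one.2 fun a ha b hb =>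
      hx ((Finset.mem_filter.1 ha).2.trans (Finset.mem_filter.1 hb).2.symm)
  have h2 : (Finset.univ.filter fun p => (kf p, sf p) = (K, y₀ + v)).card ≤ 1 :=
    Finset.card_le_one.2 fun a ha b hb =>
      hs ((Finset.mem_filter.1 ha).2.trans (Finset.mem_filter.1 hb).2.symm)
  omega

/-- Each label is charged at most twice, with factor `4`. The resulting `8` is rounded up to `9 = 3
^ 2` to give an integral norm. -/
lemma sum_sqNorm_oracle_reprogram_sub_le [Fintype W] [DecidableEq W]
    {P : Type*} [Fintype P] [DecidableEq P]
    {kf xf sf : P → Block n}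
    (hx : Function.Injective fun p => (kf p, xf p)) (hs : Function.Injective fun p => (kf p, sf p))
    (E : Cipher n) (v : Block n) (ψ : Basis n W → ℂ) :
    ∑ p, sqNorm ((oracle (reprogram E (kf p) (xf p) (v + sf p)) - oracle E) *ᵥ ψ)
      ≤ 9 * sqNorm ψ := by
  refine (Finset.sum_le_sum fun p _ => sqNorm_oracle_sub_mulVec_le _ _ ψ).trans ?_
  rw [← Finset.mul_sum, Finset.sum_comm]
  have hpt (t : Basis n W) :
      ∑ p, (if oracleMap (reprogram E (kf p) (xf p) (v + sf p)) t ≠ oracleMap E t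
        then ‖ψ t‖ ^ 2 else 0) ≤ 2 * ‖ψ t‖ ^ 2 := by
    rw [← Finset.sum_filter, Finset.sum_const, nsmul_eq_mul]
    refine mul_le_mul_of_nonneg_right ?_ (sq_nonneg _)
    exact_mod_cast card_oracleMap_reprogram_ne_le hx hs E v t
  have := Finset.sum_le_sum fun t (_ : t ∈ Finset.univ) => hpt t
  rw [← Finset.mul_sum] at this
  have h0 := sqNorm_nonneg ψ
  simp only [sqNorm] at h0 ⊢
  linarith

end Oracle

end PGV

namespace PGV

/-! ### Counting ciphers with prescribed values -/

section Counting

variable {n : ℕ}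

lemma card_block : Fintype.card (Block n) = 2 ^ n := by simp [ZMod.card]

lemma eight_le_two_pow (hn : 3 ≤ n) : 8 ≤ 2 ^ n :=
  (by norm_num : 8 = 2 ^ 3).trans_le (Nat.pow_le_pow_right (by norm_num) hn)

lemma le_card_sigma_erase (hn : 3 ≤ n) (y y' : Block n) :
    ((2 : ℝ) ^ n - 1) * (2 ^ n - 2) ≤
      (((Finset.univ.erase y').sigma fun z => (Finset.univ.erase y).erase z :
        Finset (Σ _ : Block n, Block n)).card : ℝ) := by
  have h2 (z : Block n) : 2 ^ n - 2 ≤ ((Finset.univ.erase y).erase z).card := by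
    have := Finset.pred_card_le_card_erase (s := Finset.univ.erase y) (a := z)
    rw [Finset.card_erase_of_mem (Finset.mem_univ y), Finset.card_univ, card_block] at this
    omega
  have h1 := Finset.card_nsmul_le_sum (Finset.univ.erase y') _ _ fun z _ => h2 z
  rw [Finset.card_erase_of_mem (Finset.mem_univ y'), Finset.card_univ, card_block,
    smul_eq_mul, ← Finset.card_sigma] at h1
  have hN := eight_le_two_pow hn
  refine le_of_eq_of_le ?_ (Nat.cast_le.2 h1)
  rw [Nat.cast_mul, Nat.cast_sub (by omega), Nat.cast_sub (by omega)]
  push_cast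
  rfl

/-- Averaging over the ciphers with two prescribed values is dominated by averaging over the
reprogrammings of arbitrary ciphers to these values. -/
lemma mul_sum_prescribed_le (hn : 3 ≤ n) {k x k' x' : Block n} (hne : (k, x) ≠ (k', x'))
    (y y' : Block n) {g : Cipher n → ℝ} (hg : ∀ F, 0 ≤ g F) :
    ((2 : ℝ) ^ n - 1) * (2 ^ n - 2) * ∑ F, (if F k x = y ∧ F k' x' = y' then g F else 0)
      ≤ ∑ E, if E k x ≠ y' ∧ E k' x' ≠ y then g (reprogram (reprogram E k x y) k' x' y')
        else 0 := by
  rw [← Finset.sum_filter, ← Finset.sum_filter]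
  set A : Finset (Cipher n) := Finset.univ.filter fun F => F k x = y ∧ F k' x' = y' with hA
  set Z : Finset (Σ _ : Block n, Block n) :=
    (Finset.univ.erase y').sigma fun z => (Finset.univ.erase y).erase z with hZ
  have hcard : ((2 : ℝ) ^ n - 1) * (2 ^ n - 2) ≤ Z.card := le_card_sigma_erase hn y y'
  -- The inverse construction: give `F` former values `z`, `z'` at the two points. Requiring `z ≠
  -- y'`, `z' ≠ y` and `z' ≠ z` prevents interference, so `F`, `z` and `z'` can all be recovered
  -- from the result.
  set i : Cipher n × (Σ _ : Block n, Block n) → Cipher n := fun a =>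
    reprogram (reprogram a.1 k' x' a.2.2) k x a.2.1 with hi
  have key : ∀ a ∈ A ×ˢ Z, i a k x = a.2.1 ∧ i a k' x' = a.2.2 ∧ a.2.1 ≠ y' ∧ a.2.2 ≠ y ∧
      reprogram (reprogram (i a) k x y) k' x' y' = a.1 := by
    rintro ⟨F, z, z'⟩ ha
    simp only [hA, hZ, Finset.mem_product, Finset.mem_filter, Finset.mem_univ, true_and,
      Finset.mem_sigma, Finset.mem_erase, and_true] at ha
    obtain ⟨⟨rfl, rfl⟩, hz, hz', hz''⟩ := ha
    have h1 : reprogram F k' x' z' k x = F k x := reprogram_apply_of_ne F hne hz''.symm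
    refine ⟨reprogram_apply_self _ _ _ _, ?_, hz, hz'', ?_⟩
    · have h2 := reprogram_apply_self F k' x' z'
      simp only [hi]
      rw [reprogram_apply_of_ne _ hne.symm (by rw [h2]; exact hz'), h2]
    · have h3 := reprogram_reprogram (reprogram F k' x' z') k x z
      rw [h1] at h3
      simp only [hi]
      rw [h3, reprogram_reprogram]
  have hinj : Set.InjOn i (A ×ˢ Z : Finset _) := by
    intro a ha b hb hab
    obtain ⟨ha1, ha2, -, -, ha3⟩ := key a ha
    obtain ⟨hb1, hb2, -, -, hb3⟩ := key b hb
    rw [hab] at ha1 ha2 ha3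
    exact Prod.ext (ha3.symm.trans hb3)
      (Sigma.ext (ha1.symm.trans hb1) (heq_of_eq (ha2.symm.trans hb2)))
  calc ((2 : ℝ) ^ n - 1) * (2 ^ n - 2) * ∑ F ∈ A, g F
      ≤ Z.card * ∑ F ∈ A, g F :=
        mul_le_mul_of_nonneg_right hcard (Finset.sum_nonneg fun F _ => hg F)
    _ = ∑ a ∈ A ×ˢ Z, g a.1 := by
        rw [Finset.sum_product, Finset.mul_sum]
        simp
    _ = ∑ a ∈ A ×ˢ Z, g (reprogram (reprogram (i a) k x y) k' x' y') :=
        Finset.sum_congr rfl fun a ha => by rw [(key a ha).2.2.2.2]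
    _ = ∑ E ∈ (A ×ˢ Z).image i, g (reprogram (reprogram E k x y) k' x' y') :=
        (Finset.sum_image (f := fun E => g (reprogram (reprogram E k x y) k' x' y')) hinj).symm
    _ ≤ _ := by
        refine Finset.sum_le_sum_of_subset_of_nonneg ?_ fun _ _ _ => hg _
        intro E hE
        obtain ⟨a, ha, rfl⟩ := Finset.mem_image.1 hE
        obtain ⟨h1, h2, h3, h4, -⟩ := key a ha
        simp only [Finset.mem_filter, Finset.mem_univ, true_and]
        exact ⟨h1 ▸ h3, h2 ▸ h4⟩

end Counting

/-! ### The collision bound -/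

namespace QuantumAlgorithm

variable {n : ℕ} {W : Type*} [Fintype W] [DecidableEq W]

/-- The probability that the algorithm outputs `o` when the oracle is `E`. -/
noncomputable def outputProb (A : QuantumAlgorithm n W) (E : Cipher n)
    (o : (Block n × Block n) × (Block n × Block n)) : ℝ :=
  ∑ s, if A.output s = o then ‖A.finalState E s‖ ^ 2 else 0

lemma outputProb_nonneg (A : QuantumAlgorithm n W) (E : Cipher n)
    (o : (Block n × Block n) × (Block n × Block n)) : 0 ≤ A.outputProb E o :=
  Finset.sum_nonneg fun _ _ => by positivity

open scoped Classical in
lemma collisionProbAt_eq (A : QuantumAlgorithm n W) (f : Cipher n → Block n × Block n → Block n)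
    (E : Cipher n) :
    A.collisionProbAt f E = ∑ o, if IsCollision (f E) o then A.outputProb E o else 0 := by
  simp only [collisionProbAt, outputProb]
  have h (o : (Block n × Block n) × (Block n × Block n)) :
      (if IsCollision (f E) o then
        ∑ s, (if A.output s = o then ‖A.finalState E s‖ ^ 2 else 0) else 0)
      = ∑ s, if A.output s = o then
          (if IsCollision (f E) o then ‖A.finalState E s‖ ^ 2 else 0) else 0 := by
    split_ifs <;> simp
  simp only [h]
  rw [Finset.sum_comm]
  simp

/-- Reprogramming the oracle so that two inputs get the common value `v` raises the total
probability of outputting these inputs to at most `(1 + 3q)⁴`. -/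
lemma sum_outputProb_reprogram_le (A : QuantumAlgorithm n W) {kf xf sf : Block n × Block n → Block n}
    (hx : Function.Injective fun p => (kf p, xf p)) (hs : Function.Injective fun p => (kf p, sf p))
    (E : Cipher n) (v : Block n) :
    ∑ o : (Block n × Block n) × (Block n × Block n),
      (if o.1 ≠ o.2 ∧ E (kf o.1) (xf o.1) ≠ v + sf o.2 ∧ E (kf o.2) (xf o.2) ≠ v + sf o.1 then
        A.outputProb (reprogram (reprogram E (kf o.1) (xf o.1) (v + sf o.1))
          (kf o.2) (xf o.2) (v + sf o.2)) o else 0)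
      ≤ (1 + 3 * (A.numQueries : ℝ)) ^ 4 := by
  rw [← Finset.sum_filter]
  refine sum_output_evolve_le (U₀ := oracle E)
    (U₁ := fun p => oracle (reprogram E (kf p) (xf p) (v + sf p)))
    (U₂ := fun o => oracle (reprogram (reprogram E (kf o.1) (xf o.1) (v + sf o.1))
          (kf o.2) (xf o.2) (v + sf o.2)))
    (sqNorm_oracle_mulVec E) (fun _ => sqNorm_oracle_mulVec _) (fun _ => sqNorm_oracle_mulVec _)
    (sum_sqNorm_oracle_reprogram_sub_le hx hs E v) ?_ A.steps
    (ψ := A.first.1 *ᵥ Pi.single A.start 1) ?_ A.output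
  · intro o ho
    obtain ⟨hne, h1, h2⟩ := (Finset.mem_filter.1 ho).2
    refine oracle_reprogram_reprogram E (fun h => hne (hx h)) (fun hk h => hne (hs ?_)) h1 h2
    exact Prod.ext hk (add_left_cancel h)
  · rw [sqNorm_unitary_mulVec]
    simp only [sqNorm, Pi.single_apply]
    rw [Finset.sum_eq_single A.start] <;> simp +contextual

/-- The collision bound for functions `E_k(x) ⊕ s` such that both `(k, x)` and `(k, s)` determine
the input. -/
theorem collisionProb_le (hn : 3 ≤ n) (A : QuantumAlgorithm n W)
    {kf xf sf : Block n × Block n → Block n}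
    (hx : Function.Injective fun p => (kf p, xf p))
    (hs : Function.Injective fun p => (kf p, sf p)) :
    A.collisionProb (fun E p => E (kf p) (xf p) + sf p)
      ≤ (1 + 3 * (A.numQueries : ℝ)) ^ 4 / (2 ^ n - 4) := by
  set f : Cipher n → Block n × Block n → Block n := fun E p => E (kf p) (xf p) + sf p with hf
  have hN : (8 : ℝ) ≤ 2 ^ n := by exact_mod_cast eight_le_two_pow hn
  set N : ℝ := (2 : ℝ) ^ n with hNdef
  set M : ℝ := (1 + 3 * (A.numQueries : ℝ)) ^ 4 with hM
  have hM0 : 0 ≤ M := by positivity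
  -- Each collision is counted once, at its common value `v`; in characteristic two `f E p = v`
  -- prescribes the cipher value `v + sf p`.
  have hsplit (E : Cipher n) : A.collisionProbAt f E
      = ∑ v, ∑ o : (Block n × Block n) × (Block n × Block n), if o.1 ≠ o.2 then
        (if E (kf o.1) (xf o.1) = v + sf o.1 ∧ E (kf o.2) (xf o.2) = v + sf o.2 then
          A.outputProb E o else 0) else 0 := by
    rw [collisionProbAt_eq, Finset.sum_comm]
    refine Finset.sum_congr rfl fun o _ => ?_
    by_cases ho : o.1 = o.2
    · simp [IsCollision, ho]
    have hmove (p : Block n × Block n) (v : Block n) :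
        E (kf p) (xf p) = v + sf p ↔ f E p = v :=
      ⟨fun h => by simp only [hf]; rw [h, Block.add_add_cancel],
        fun h => by rw [← h]; simp only [hf]; rw [Block.add_add_cancel]⟩
    simp only [IsCollision, ne_eq, ho, not_false_eq_true, true_and, if_true, hmove, ite_and,
      Finset.sum_ite_eq, Finset.mem_univ]
    simp only [eq_comm (a := f E o.2)]
  have htotal : (N - 1) * (N - 2) * ∑ E, A.collisionProbAt f E
      ≤ Fintype.card (Cipher n) * (N * M) := by
    calc (N - 1) * (N - 2) * ∑ E, A.collisionProbAt f E
        = ∑ v, ∑ o : (Block n × Block n) × (Block n × Block n), if o.1 ≠ o.2 then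
          (N - 1) * (N - 2) * ∑ E : Cipher n,
            (if E (kf o.1) (xf o.1) = v + sf o.1 ∧ E (kf o.2) (xf o.2) = v + sf o.2 then
              A.outputProb E o else 0) else 0 := by
          simp only [hsplit]
          rw [Finset.sum_comm, Finset.mul_sum]
          refine Finset.sum_congr rfl fun v _ => ?_
          rw [Finset.sum_comm, Finset.mul_sum]
          refine Finset.sum_congr rfl fun o _ => ?_
          split_ifs <;> simp
      _ ≤ ∑ v, ∑ o : (Block n × Block n) × (Block n × Block n), ∑ E : Cipher n,
          if o.1 ≠ o.2 ∧ E (kf o.1) (xf o.1) ≠ v + sf o.2 ∧ E (kf o.2) (xf o.2) ≠ v + sf o.1 then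
            A.outputProb (reprogram (reprogram E (kf o.1) (xf o.1) (v + sf o.1))
              (kf o.2) (xf o.2) (v + sf o.2)) o else 0 := by
          refine Finset.sum_le_sum fun v _ => Finset.sum_le_sum fun o _ => ?_
          by_cases ho : o.1 = o.2
          · simp [ho]
          · rw [if_pos ho]
            refine (mul_sum_prescribed_le hn (fun h => ho (hx h)) _ _
              fun F => A.outputProb_nonneg F o).trans_eq (Finset.sum_congr rfl fun E _ => ?_)
            simp only [ne_eq, ho, not_false_eq_true, true_and]
      _ ≤ ∑ _v : Block n, ∑ _E : Cipher n, M := by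
          refine Finset.sum_le_sum fun v _ => ?_
          rw [Finset.sum_comm]
          exact Finset.sum_le_sum fun E _ => A.sum_outputProb_reprogram_le hx hs E v
      _ = Fintype.card (Cipher n) * (N * M) := by
          rw [Finset.sum_const, Finset.sum_const, Finset.card_univ, Finset.card_univ, card_block,
            nsmul_eq_mul, nsmul_eq_mul, Nat.cast_pow, Nat.cast_ofNat]
          ring
  have hC : (0 : ℝ) < Fintype.card (Cipher n) := by exact_mod_cast Fintype.card_pos
  rw [collisionProb, div_le_div_iff₀ hC (by linarith)]
  have hS : 0 ≤ ∑ E, A.collisionProbAt f E :=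
    Finset.sum_nonneg fun E _ => Finset.sum_nonneg fun s _ => by positivity
  -- After multiplication by `N`, the remaining estimate is `N(N - 4) ≤ (N - 1)(N - 2)`.
  refine le_of_mul_le_mul_left ?_ (by linarith : 0 < N)
  nlinarith

end QuantumAlgorithm

/-- Any two distinct members of `{h, m, h ⊕ m}` determine `(h, m)`; this is where the group-1
conditions `x ≠ k` and `s ≠ k` enter. -/
lemma Scheme.injective_of_mem_groupOne {n : ℕ} (c : Block n) {S : Scheme} (hS : S ∈ groupOne) :
    (Function.Injective fun p : Block n × Block n => (S.k.eval c p.1 p.2, S.x.eval c p.1 p.2)) ∧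
    (Function.Injective fun p : Block n × Block n => (S.k.eval c p.1 p.2, S.s.eval c p.1 p.2)) := by
  simp only [groupOne, List.mem_cons, List.not_mem_nil, or_false] at hS
  rcases hS with rfl | rfl | rfl | rfl | rfl | rfl | rfl | rfl | rfl | rfl | rfl | rfl <;>
  · constructor <;>
    · rintro ⟨h, m⟩ ⟨h', m'⟩ he
      simp only [Term.eval, Prod.mk.injEq] at he ⊢
      obtain ⟨h1, h2⟩ := he
      simp_all

end PGV

theorem mainTheorem12 :
    (∀ (n q : ℕ), 3 ≤ n →
      ∀ (c : PGV.Block n) (S : PGV.Scheme), S ∈ PGV.groupOne →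
      ∀ (W : Type*) [Fintype W] [DecidableEq W] (A : PGV.QuantumAlgorithm n W),
        A.numQueries ≤ q →
        A.collisionProb (S.compress c) ≤ 6 * (8 * (q : ℝ) + 1) ^ 4 / ((2 : ℝ) ^ n - 4)) ∧
    (∃ C : ℝ, 0 < C ∧ ∀ (n q : ℕ), 3 ≤ n → 1 ≤ q →
      6 * (8 * (q : ℝ) + 1) ^ 4 / ((2 : ℝ) ^ n - 4) ≤ C * ((q : ℝ) ^ 4 / (2 : ℝ) ^ n)) ∧
    (∃ S ∈ PGV.groupOne, ∀ (n : ℕ) (c : PGV.Block n) (E : PGV.Cipher n),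
      S.compress c E = PGV.daviesMeyer E) := by
  have hN (n : ℕ) (hn : 3 ≤ n) : (8 : ℝ) ≤ 2 ^ n := by exact_mod_cast PGV.eight_le_two_pow hn
  -- The constant comes from `8q + 1 ≤ 9q` and, since `2 ^ n ≥ 8`, from `2 ^ n ≤ 2(2 ^ n - 4)`.
  refine ⟨?_, ⟨12 * 9 ^ 4, by norm_num, ?_⟩, ⟨⟨.msg, .chain, .chain⟩, ?_, fun _ _ _ => rfl⟩⟩
  · intro n q hn c S hS W _ _ A hq
    obtain ⟨hx, hs⟩ := PGV.Scheme.injective_of_mem_groupOne c hS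
    have hq' : (A.numQueries : ℝ) ≤ q := by exact_mod_cast hq
    refine (A.collisionProb_le hn hx hs).trans ?_
    have h8 := hN n hn
    refine div_le_div_of_nonneg_right ?_ (by linarith)
    -- The bound proved is stronger: both the factor `6` and the `8` in place of `3` are slack.
    have h1 : (1 + 3 * (A.numQueries : ℝ)) ^ 4 ≤ (8 * (q : ℝ) + 1) ^ 4 :=
      pow_le_pow_left₀ (by positivity) (by linarith [Nat.cast_nonneg (α := ℝ) q]) 4
    have h2 : 0 ≤ (8 * (q : ℝ) + 1) ^ 4 := by positivity
    linarith
  · intro n q hn hq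
    have h8 := hN n hn
    have hq' : (1 : ℝ) ≤ q := by exact_mod_cast hq
    have h1 : (8 * (q : ℝ) + 1) ^ 4 ≤ (9 * q) ^ 4 :=
      pow_le_pow_left₀ (by positivity) (by linarith) 4
    rw [← mul_div_assoc, div_le_div_iff₀ (by linarith) (by positivity)]
    calc 6 * (8 * (q : ℝ) + 1) ^ 4 * 2 ^ n ≤ 6 * (9 * q) ^ 4 * (2 * (2 ^ n - 4)) := by
          refine mul_le_mul (by linarith) (by linarith) (by positivity) (by positivity)
      _ = 12 * 9 ^ 4 * (q : ℝ) ^ 4 * (2 ^ n - 4) := by ring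
  · simp [PGV.groupOne]
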